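/- An $n\times n$ bipartite graph is a bipartite graph $G=(A\cup B,E)$ with a fixed bipartition into parts $A,B$ with $|A|=|B|=n$. A bi-hole of size $k$ in $G$ is a pair $(X,Y)$ with $X\subseteq A$, $Y\subseteq B$ and $|X|=|Y|=k$ such that $G$ has no edge with one endpoint in $X$ and the other in $Y$. Let $f(n,\Delta)$ be the largest integer $k$ such that every $n\times n$ bipartite graph with $\deg(a)\le\Delta$ for all $a\in A$ contains a bi-hole of size $k$, and let $f^*(n,\Delta)$ be the largest integer $k$ such that every $n\times n$ bipartite graph with maximum degree at most $\Delta$ contains a bi-hole of size $k$. Theorem. (i) For every integer $\Delta\ge 2$ and every integer $n\ge 0$, $f(n,\Delta)\ge\left\lfloor\frac{n-2}{\Delta}\right\rfloor$. (ii) For every integer $n\ge 1$, $f(n,2)=\lceil n/2\rceil-1$. (iii) There exists $n_0$ such that for every integer $n>n_0$, $0.3411\,n<f(n,3)\le f^*(n,3)<0.4591\,n$. -/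

import Mathlib

/-- `G` is an `n × n` bipartite graph with parts `A` (the vertices `Sum.inl i`) and
`B` (the vertices `Sum.inr j`): a spanning subgraph of the complete bipartite graph `K_{n,n}`. -/
def IsBipartiteNN {n : ℕ} (G : SimpleGraph (Fin n ⊕ Fin n)) : Prop :=
  G ≤ completeBipartiteGraph (Fin n) (Fin n)

/-- The pair `(X, Y)` with `X ⊆ A` and `Y ⊆ B` is a bi-hole of size `k` in `G`. -/
def IsBihole {n : ℕ} (G : SimpleGraph (Fin n ⊕ Fin n)) (k : ℕ) (X Y : Finset (Fin n)) : Prop :=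
  X.card = k ∧ Y.card = k ∧ ∀ x ∈ X, ∀ y ∈ Y, ¬ G.Adj (Sum.inl x) (Sum.inr y)

/-- The integers `k` such that every `n × n` bipartite graph all of whose vertices in `A` have
degree at most `Δ` contains a bi-hole of size `k`. -/
def biholeSizes (n Δ : ℕ) : Set ℕ :=
  {k | ∀ (G : SimpleGraph (Fin n ⊕ Fin n)) [DecidableRel G.Adj], IsBipartiteNN G →
    (∀ a : Fin n, G.degree (Sum.inl a) ≤ Δ) → ∃ X Y : Finset (Fin n), IsBihole G k X Y}

/-- The integers `k` such that every `n × n` bipartite graph of maximum degree at most `Δ`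
contains a bi-hole of size `k`. -/
def biholeSizesStar (n Δ : ℕ) : Set ℕ :=
  {k | ∀ (G : SimpleGraph (Fin n ⊕ Fin n)) [DecidableRel G.Adj], IsBipartiteNN G →
    G.maxDegree ≤ Δ → ∃ X Y : Finset (Fin n), IsBihole G k X Y}

/-- The function `f(n, Δ)`: the largest element of `biholeSizes n Δ`
(see `isGreatest_biholeNumber`). -/
noncomputable def biholeNumber (n Δ : ℕ) : ℕ := sSup (biholeSizes n Δ)

/-- The function `f*(n, Δ)`: the largest element of `biholeSizesStar n Δ`
(see `isGreatest_biholeNumberStar`). -/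
noncomputable def biholeNumberStar (n Δ : ℕ) : ℕ := sSup (biholeSizesStar n Δ)

theorem isGreatest_biholeNumberStar (n Δ : ℕ) :
    IsGreatest (biholeSizesStar n Δ) (biholeNumberStar n Δ) := by
  have hb : BddAbove (biholeSizesStar n Δ) := by
    refine ⟨n, fun k hk => ?_⟩
    classical
    obtain ⟨X, Y, hX, -, -⟩ := hk ⊥ (by simp [IsBipartiteNN]) (by simp)
    rw [← hX]
    simpa using X.card_le_univ
  have hne : (biholeSizesStar n Δ).Nonempty :=
    ⟨0, fun G _ _ _ => ⟨∅, ∅, by simp [IsBihole]⟩⟩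
  exact ⟨Nat.sSup_mem hne hb, fun k hk => le_csSup hb hk⟩

theorem isGreatest_biholeNumber (n Δ : ℕ) :
    IsGreatest (biholeSizes n Δ) (biholeNumber n Δ) := by
  have hb : BddAbove (biholeSizes n Δ) := by
    refine ⟨n, fun k hk => ?_⟩
    classical
    obtain ⟨X, Y, hX, -, -⟩ := hk ⊥ (by simp [IsBipartiteNN]) (by simp)
    rw [← hX]
    simpa using X.card_le_univ
  have hne : (biholeSizes n Δ).Nonempty :=
    ⟨0, fun G _ _ _ => ⟨∅, ∅, by simp [IsBihole]⟩⟩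
  exact ⟨Nat.sSup_mem hne hb, fun k hk => le_csSup hb hk⟩

/-!
Lower bounds. A bi-hole of size `k` is a set `X` of `k` vertices of `A` with at most `n - k`
neighbours. Regard the neighbourhoods of the vertices of `A` as a family of sets of size at most
`D + 1`. If the union of a family has at most `D` times as many elements as the family has members,
then every `k` up to the size of the family admits `k` members whose union has at most `D * k + 1`
elements (`exists_subfamily_card_biUnion_le`): within a connected family one grows the subfamily by
sets meeting the current union, and components are used up in the order of their excess. With
`D = Δ - 1` this gives a bi-hole of size `k` as soon as `Δ * k + 1 ≤ n`.

For `Δ = 3` one does better by first putting a set `U` of `n - w` vertices of `B` into the cover. On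
average `U` misses only a `(w / n) ^ 3` proportion of the neighbourhoods of size `3`; all the others
have at most two elements outside `U`. If `w / n + (w / n) ^ 3 ≤ 1`, there are at least `w` such
vertices of `A`, and the statement on families with `D = 1`, applied on the `w` vertices outside `U`,
gives a bi-hole of size about `w / 2` (`mem_biholeSizes_three`).

Upper bounds. For `Δ = 2` the graph is the cycle of length `2 * n`. For `Δ = 3` it is a union of three
random perfect matchings, whose expected number of bi-holes of size `k` is
`(n - k).choose k ^ 3 / n.choose k` (`not_mem_biholeSizesStar_three`). By Stirling's formula this is
`exp (n * biholeRate (k / n))` up to a polynomial factor, and `biholeRate 0.4591 < 0`.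
-/

/-! ### Sparse subfamilies of set systems -/

/-- Either one can grow a family of every size, adding each time a set that meets the union of the
previous ones, or the family splits into two parts with disjoint unions. -/
theorem exists_connected_subfamily_or_split {α β : Type*} [DecidableEq α] [DecidableEq β]
    (N : α → Finset β) (D : ℕ) (F : Finset α) (hN : ∀ a ∈ F, (N a).card ≤ D + 1) :
    (∀ k ≤ F.card, ∃ S ⊆ F, S.card = k ∧ (S.biUnion N).card ≤ D * k + 1) ∨
    ∃ S ⊂ F, S.Nonempty ∧ Disjoint (S.biUnion N) ((F \ S).biUnion N) := by
  by_cases hsplit : ∃ S ⊂ F, S.Nonempty ∧ Disjoint (S.biUnion N) ((F \ S).biUnion N)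
  · exact Or.inr hsplit
  left
  intro k
  induction k with
  | zero => exact fun _ => ⟨∅, by simp⟩
  | succ k ih =>
    intro hk
    obtain ⟨S, hSF, hSk, hSN⟩ := ih (by omega)
    have hss : S ⊂ F := hSF.ssubset_of_ne (by rintro rfl; omega)
    rcases S.eq_empty_or_nonempty with rfl | hne
    · obtain ⟨a, ha⟩ : F.Nonempty := Finset.card_pos.1 (by omega)
      obtain rfl : k = 0 := by simpa using hSk.symm
      exact ⟨{a}, by simpa using ha, by simp, by simpa using hN a ha⟩
    · have hnd : ¬ Disjoint (S.biUnion N) ((F \ S).biUnion N) := fun h => hsplit ⟨S, hss, hne, h⟩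
      obtain ⟨y, hyS, hyF⟩ := Finset.not_disjoint_iff.1 hnd
      obtain ⟨a, ha, hya⟩ := Finset.mem_biUnion.1 hyF
      obtain ⟨haF, haS⟩ := Finset.mem_sdiff.1 ha
      refine ⟨insert a S, Finset.insert_subset haF hSF, by simp [haS, hSk], ?_⟩
      rw [Finset.biUnion_insert]
      have h1 := Finset.card_union_add_card_inter (N a) (S.biUnion N)
      have h2 : 0 < (N a ∩ S.biUnion N).card := Finset.card_pos.2 ⟨y, by simp [hya, hyS]⟩
      have h3 := hN a haF
      rw [mul_add]
      omega

/-- A family of sets of size at most `D + 1` whose union exceeds `D` times its size by at most `c`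
has subfamilies of every size `k` with union of size at most `D * k + c + 1`. When the family splits
into parts with disjoint unions, one exhausts the part with the smaller excess before
using the other one. -/
theorem exists_subfamily_card_biUnion_le_add {α β : Type*} [DecidableEq α] [DecidableEq β]
    (N : α → Finset β) (D : ℕ) (F : Finset α) (hN : ∀ a ∈ F, (N a).card ≤ D + 1)
    (c : ℤ) (hc : 0 ≤ c) (hF : ((F.biUnion N).card : ℤ) ≤ D * F.card + c) (k : ℕ)
    (hk : k ≤ F.card) :
    ∃ S ⊆ F, S.card = k ∧ ((S.biUnion N).card : ℤ) ≤ D * k + c + 1 := by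
  induction F using Finset.strongInduction generalizing c k with
  | H F ih =>
    rcases exists_connected_subfamily_or_split N D F hN with h | ⟨S, hSF, hSne, hdisj⟩
    · obtain ⟨S, hSF, hSk, hS⟩ := h k hk
      refine ⟨S, hSF, hSk, ?_⟩
      have : ((S.biUnion N).card : ℤ) ≤ D * k + 1 := by exact_mod_cast hS
      linarith
    · -- the conclusion, provided that the first of the two parts has the smaller excess
      have key : ∀ S T : Finset α, S ⊂ F → T ⊂ F → S ∪ T = F → Disjoint S T →
          Disjoint (S.biUnion N) (T.biUnion N) →
          ((S.biUnion N).card : ℤ) - D * S.card ≤ (T.biUnion N).card - D * T.card →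
          ∃ S ⊆ F, S.card = k ∧ ((S.biUnion N).card : ℤ) ≤ D * k + c + 1 := by
        intro S T hS hT hST hd hdN hle
        have hcard : (F.card : ℤ) = S.card + T.card := by
          rw [← hST, Finset.card_union_of_disjoint hd]; push_cast; ring
        have hN' : ((F.biUnion N).card : ℤ) = (S.biUnion N).card + (T.biUnion N).card := by
          rw [← hST, Finset.union_biUnion, Finset.card_union_of_disjoint hdN]; push_cast; ring
        rw [hN', hcard, mul_add] at hF
        by_cases hkS : k ≤ S.card
        · obtain ⟨R, hR, hRk, hRN⟩ := ih S hS (fun a ha => hN a (hS.1 ha)) c hc (by linarith) k hkS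
          exact ⟨R, hR.trans hS.1, hRk, hRN⟩
        · obtain ⟨j, rfl⟩ := Nat.exists_eq_add_of_le (not_le.1 hkS).le
          obtain ⟨R, hR, hRk, hRN⟩ := ih T hT (fun a ha => hN a (hT.1 ha))
            (max ((T.biUnion N).card - D * T.card) 0) (le_max_right _ _)
            (by linarith [le_max_left (((T.biUnion N).card : ℤ) - D * T.card) 0]) j
            (by omega)
          refine ⟨S ∪ R, Finset.union_subset hS.1 (hR.trans hT.1), ?_, ?_⟩
          · rw [Finset.card_union_of_disjoint (hd.mono_right hR), hRk]
          · rw [Finset.union_biUnion]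
            have h1 : (((S.biUnion N) ∪ (R.biUnion N)).card : ℤ)
                ≤ (S.biUnion N).card + (R.biUnion N).card := by
              exact_mod_cast Finset.card_union_le _ _
            push_cast
            rw [mul_add]
            rcases max_cases (((T.biUnion N).card : ℤ) - D * T.card) 0 with ⟨h, _⟩ | ⟨h, _⟩ <;>
              rw [h] at hRN <;> linarith
      have hTF : F \ S ⊂ F := Finset.sdiff_ssubset hSF.1 hSne
      rcases le_total (((S.biUnion N).card : ℤ) - D * S.card)
        (((F \ S).biUnion N).card - D * (F \ S).card) with hle | hle
      · exact key S (F \ S) hSF hTF (Finset.union_sdiff_of_subset hSF.1) Finset.disjoint_sdiff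
          hdisj hle
      · exact key (F \ S) S hTF hSF (Finset.sdiff_union_of_subset hSF.1) Finset.sdiff_disjoint
          hdisj.symm hle

theorem exists_subfamily_card_biUnion_le {α β : Type*} [DecidableEq α] [DecidableEq β]
    (N : α → Finset β) (D : ℕ) (F : Finset α) (hN : ∀ a ∈ F, (N a).card ≤ D + 1)
    (hF : (F.biUnion N).card ≤ D * F.card) (k : ℕ) (hk : k ≤ F.card) :
    ∃ S ⊆ F, S.card = k ∧ (S.biUnion N).card ≤ D * k + 1 := by
  obtain ⟨S, h1, h2, h3⟩ := exists_subfamily_card_biUnion_le_add N D F hN 0 le_rfl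
    (by simpa using (by exact_mod_cast hF : ((F.biUnion N).card : ℤ) ≤ D * F.card)) k hk
  exact ⟨S, h1, h2, by simpa using (by exact_mod_cast h3 : (S.biUnion N).card ≤ D * k + 0 + 1)⟩

/-! ### Lower bounds -/

open Classical in
/-- The neighbourhood in `B` of a vertex of `A`, as a set of indices. -/
noncomputable def nbrs {n : ℕ} (G : SimpleGraph (Fin n ⊕ Fin n)) (a : Fin n) : Finset (Fin n) :=
  Finset.univ.filter fun b => G.Adj (Sum.inl a) (Sum.inr b)

theorem mem_nbrs {n : ℕ} {G : SimpleGraph (Fin n ⊕ Fin n)} {a b : Fin n} :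
    b ∈ nbrs G a ↔ G.Adj (Sum.inl a) (Sum.inr b) := by
  simp [nbrs]

theorem card_nbrs_le {n : ℕ} (G : SimpleGraph (Fin n ⊕ Fin n)) [DecidableRel G.Adj] (a : Fin n) :
    (nbrs G a).card ≤ G.degree (Sum.inl a) := by
  rw [← SimpleGraph.card_neighborFinset_eq_degree]
  refine Finset.card_le_card_of_injOn Sum.inr (fun b hb => ?_) Sum.inr_injective.injOn
  simpa [mem_nbrs] using hb

/-- Any `k` vertices of the complement of the neighbourhood of `X` complete `X` to a bi-hole. -/
theorem exists_isBihole_of_card_biUnion_le {n k : ℕ} (G : SimpleGraph (Fin n ⊕ Fin n))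
    (X : Finset (Fin n)) (hX : X.card = k) (h : (X.biUnion (nbrs G)).card + k ≤ n) :
    ∃ X Y : Finset (Fin n), IsBihole G k X Y := by
  have hc : k ≤ (X.biUnion (nbrs G))ᶜ.card := by
    rw [Finset.card_compl, Fintype.card_fin]; omega
  obtain ⟨Y, hY, hYk⟩ := Finset.exists_subset_card_eq hc
  refine ⟨X, Y, hX, hYk, fun x hx y hy hadj => ?_⟩
  have := hY hy
  simp only [Finset.mem_compl, Finset.mem_biUnion, not_exists, not_and] at this
  exact this x hx (mem_nbrs.2 hadj)

theorem mem_biholeSizes_of_mul_lt {n Δ k : ℕ} (hΔ : 2 ≤ Δ) (h : Δ * k + 1 ≤ n) :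
    k ∈ biholeSizes n Δ := by
  intro G _ _ hdeg
  obtain ⟨D, rfl⟩ : ∃ D, Δ = D + 1 := ⟨Δ - 1, by omega⟩
  have hkn : k ≤ n := by nlinarith
  obtain ⟨X, -, hX, hXN⟩ := exists_subfamily_card_biUnion_le (nbrs G) D Finset.univ
    (fun a _ => (card_nbrs_le G a).trans (hdeg a))
    ((Finset.card_le_univ _).trans (by simp; nlinarith)) k (by simpa using hkn)
  exact exists_isBihole_of_card_biUnion_le G X hX (by nlinarith)

/-- Averaging over all sets `U` of size `s`: some `U` misses at most a `((n - s) / n) ^ 3` proportion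
of the members of a family of 3-sets. -/
theorem exists_card_eq_few_disjoint {n s : ℕ} {α : Type*} [DecidableEq α] (F : Finset α)
    (N : α → Finset (Fin n)) (hN : ∀ a ∈ F, (N a).card = 3) (hs : s ≤ n) :
    ∃ U : Finset (Fin n), U.card = s ∧
      (F.filter fun a => Disjoint (N a) U).card * n ^ 3 ≤ F.card * (n - s) ^ 3 := by
  have hsum : ∑ U ∈ Finset.powersetCard s (Finset.univ : Finset (Fin n)),
      (F.filter fun a => Disjoint (N a) U).card = F.card * (n - 3).choose s := by
    simp_rw [Finset.card_filter]
    rw [Finset.sum_comm, ← smul_eq_mul, ← Finset.sum_const]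
    refine Finset.sum_congr rfl fun a ha => ?_
    rw [← Finset.card_filter]
    have : (Finset.powersetCard s (Finset.univ : Finset (Fin n))).filter
        (fun U => Disjoint (N a) U) = Finset.powersetCard s (N a)ᶜ := by
      ext U
      simp only [Finset.mem_filter, Finset.mem_powersetCard, Finset.subset_univ, true_and]
      rw [disjoint_comm, ← le_compl_iff_disjoint_right]
      exact and_comm
    rw [this, Finset.card_powersetCard, Finset.card_compl, hN a ha, Fintype.card_fin]
  rcases F.eq_empty_or_nonempty with rfl | ⟨a₀, ha₀⟩
  · obtain ⟨U, -, hU⟩ := Finset.exists_subset_card_eq (s := (Finset.univ : Finset (Fin n)))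
      (n := s) (by simpa using hs)
    exact ⟨U, hU, by simp⟩
  have hn : 3 ≤ n := by
    have := Finset.card_le_univ (N a₀); rw [hN a₀ ha₀] at this; simpa using this
  have hch : (n - 3).choose s * n ^ 3 ≤ n.choose s * (n - s) ^ 3 := by
    obtain ⟨m, rfl⟩ := Nat.exists_eq_add_of_le' hn
    have e1 := Nat.choose_mul_succ_eq m s
    have e2 := Nat.choose_mul_succ_eq (m + 1) s
    have e3 := Nat.choose_mul_succ_eq (m + 2) s
    by_cases hsm : m < s
    · simp [Nat.choose_eq_zero_of_lt hsm]
    obtain ⟨w, rfl⟩ := Nat.exists_eq_add_of_le (not_lt.1 hsm)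
    have f1 : s + w + 1 - s = w + 1 := by omega
    have f2 : s + w + 1 + 1 - s = w + 2 := by omega
    have f3 : s + w + 2 + 1 - s = w + 3 := by omega
    have f4 : s + w + 3 - s = w + 3 := by omega
    rw [f1] at e1; rw [f2] at e2; rw [f3] at e3; rw [f4]
    simp only [Nat.add_sub_cancel]
    have e4 : (s + w).choose s * ((s + w + 1) * (s + w + 2) * (s + w + 3)) =
        (s + w + 3).choose s * ((w + 1) * (w + 2) * (w + 3)) := by
      calc _ = ((s + w).choose s * (s + w + 1)) * ((s + w + 2) * (s + w + 3)) := by ring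
        _ = ((s + w + 1).choose s * (s + w + 1 + 1)) * (w + 1) * (s + w + 3) := by rw [e1]; ring
        _ = ((s + w + 2).choose s * (s + w + 2 + 1)) * (w + 1) * (w + 2) := by rw [e2]; ring
        _ = _ := by rw [e3]; ring
    have e5 : ((w + 1) * (w + 2) * (w + 3)) * (s + w + 3) ^ 3 ≤
        (w + 3) ^ 3 * ((s + w + 1) * (s + w + 2) * (s + w + 3)) := by
      have g1 : (w + 1) * (s + w + 3) ≤ (w + 3) * (s + w + 1) := by nlinarith
      have g2 : (w + 2) * (s + w + 3) ≤ (w + 3) * (s + w + 2) := by nlinarith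
      calc _ = ((w + 1) * (s + w + 3)) * ((w + 2) * (s + w + 3)) * ((w + 3) * (s + w + 3)) := by
            ring
        _ ≤ ((w + 3) * (s + w + 1)) * ((w + 3) * (s + w + 2)) * ((w + 3) * (s + w + 3)) := by
            gcongr
        _ = _ := by ring
    refine Nat.le_of_mul_le_mul_right ?_
      (by positivity : 0 < (s + w + 1) * (s + w + 2) * (s + w + 3))
    calc _ = ((s + w).choose s * ((s + w + 1) * (s + w + 2) * (s + w + 3))) * (s + w + 3) ^ 3 := by
          ring
      _ = (s + w + 3).choose s * (((w + 1) * (w + 2) * (w + 3)) * (s + w + 3) ^ 3) := by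
          rw [e4]; ring
      _ ≤ (s + w + 3).choose s *
          ((w + 3) ^ 3 * ((s + w + 1) * (s + w + 2) * (s + w + 3))) := by gcongr
      _ = _ := by ring
  by_contra! hcon
  have hlt : ∑ U ∈ Finset.powersetCard s (Finset.univ : Finset (Fin n)), F.card * (n - s) ^ 3 <
      ∑ U ∈ Finset.powersetCard s (Finset.univ : Finset (Fin n)),
        (F.filter fun a => Disjoint (N a) U).card * n ^ 3 := by
    refine Finset.sum_lt_sum_of_nonempty (Finset.powersetCard_nonempty.2 (by simpa using hs)) ?_
    intro U hU
    exact hcon U (Finset.mem_powersetCard.1 hU).2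
  rw [Finset.sum_const, ← Finset.sum_mul, hsum, Finset.card_powersetCard, Finset.card_univ,
    Fintype.card_fin, smul_eq_mul] at hlt
  have := Nat.mul_le_mul_left F.card hch
  nlinarith

/-- Put into the cover a set `U ⊆ B` of size `n - w` that meets the neighbourhoods of many vertices
of `A`. At least `w` vertices of `A` then have at most two neighbours among the `w` remaining
vertices of `B`, and these form a sparse family of pairs. -/
theorem mem_biholeSizes_three {n w k : ℕ} (hw : w ≤ n) (hwn : w * n ^ 2 + w ^ 3 ≤ n ^ 3)
    (hk : 2 * k + 1 ≤ w) : k ∈ biholeSizes n 3 := by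
  intro G _ _ hdeg
  have hN : ∀ a, (nbrs G a).card ≤ 3 := fun a => (card_nbrs_le G a).trans (hdeg a)
  set T : Finset (Fin n) := Finset.univ.filter fun a => (nbrs G a).card = 3 with hT
  obtain ⟨U, hU, hUT⟩ := exists_card_eq_few_disjoint T (nbrs G)
    (fun a ha => (Finset.mem_filter.1 ha).2) (Nat.sub_le n w)
  rw [Nat.sub_sub_self hw] at hUT
  set M := T.filter fun a => Disjoint (nbrs G a) U with hM
  have hn : 0 < n := by omega
  have hTn : T.card ≤ n := by simpa using Finset.card_le_univ T
  have hMw : M.card + w ≤ n := by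
    refine Nat.le_of_mul_le_mul_right ?_ (by positivity : 0 < n ^ 3)
    have h1 : T.card * w ^ 3 ≤ n * w ^ 3 := Nat.mul_le_mul_right _ hTn
    have h2 := Nat.mul_le_mul_left n hwn
    nlinarith
  have hMc : w ≤ Mᶜ.card := by rw [Finset.card_compl, Fintype.card_fin]; omega
  have hsmall : ∀ a ∈ Mᶜ, (nbrs G a \ U).card ≤ 1 + 1 := by
    intro a ha
    by_cases h3 : (nbrs G a).card = 3
    · have hnd : ¬ Disjoint (nbrs G a) U := fun hd => by simp [hM, hT, h3, hd] at ha
      obtain ⟨y, hy, hyU⟩ := Finset.not_disjoint_iff.1 hnd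
      have : (nbrs G a \ U).card < (nbrs G a).card :=
        Finset.card_lt_card ⟨Finset.sdiff_subset, fun h => (Finset.mem_sdiff.1 (h hy)).2 hyU⟩
      omega
    · exact (Finset.card_le_card Finset.sdiff_subset).trans (by have := hN a; omega)
  have hUc : Uᶜ.card = w := by rw [Finset.card_compl, Fintype.card_fin, hU]; omega
  have hcov : (Mᶜ.biUnion fun a => nbrs G a \ U).card ≤ 1 * Mᶜ.card := by
    rw [one_mul]
    refine le_trans (Finset.card_le_card ?_) (hUc.le.trans hMc)
    intro y hy
    obtain ⟨a, -, hya⟩ := Finset.mem_biUnion.1 hy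
    simpa using (Finset.mem_sdiff.1 hya).2
  obtain ⟨X, -, hXk, hXN⟩ := exists_subfamily_card_biUnion_le (fun a => nbrs G a \ U) 1 Mᶜ hsmall
    hcov k (by omega)
  refine exists_isBihole_of_card_biUnion_le G X hXk ?_
  have hsub : X.biUnion (nbrs G) ⊆ U ∪ X.biUnion fun a => nbrs G a \ U := by
    intro y hy
    obtain ⟨a, ha, hya⟩ := Finset.mem_biUnion.1 hy
    by_cases hyU : y ∈ U
    · exact Finset.mem_union_left _ hyU
    · exact Finset.mem_union_right _
        (Finset.mem_biUnion.2 ⟨a, ha, Finset.mem_sdiff.2 ⟨hya, hyU⟩⟩)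
  have := (Finset.card_le_card hsub).trans (Finset.card_union_le _ _)
  omega

/-- The constant `0.6823` is just below the positive root of `x + x ^ 3 = 1`. -/
theorem lt_biholeNumber_three {n : ℕ} (hn : 30000 < n) :
    (0.3411 : ℝ) * n < (biholeNumber n 3 : ℝ) := by
  set w := 6823 * n / 10000 with hw
  have hw1 : 10000 * w ≤ 6823 * n := by omega
  have hmem : (w - 1) / 2 ∈ biholeSizes n 3 := by
    refine mem_biholeSizes_three (w := w) (by omega) ?_ (by omega)
    have h3 : (10000 * w) ^ 3 ≤ (6823 * n) ^ 3 := Nat.pow_le_pow_left hw1 3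
    have h1 : 10000 * w * n ^ 2 ≤ 6823 * n * n ^ 2 := Nat.mul_le_mul_right _ hw1
    nlinarith [pow_pos (show 0 < n by omega) 3]
  have hle := (isGreatest_biholeNumber n 3).2 hmem
  have : 3411 * n < 10000 * biholeNumber n 3 := by omega
  have : (3411 : ℝ) * n < 10000 * biholeNumber n 3 := by exact_mod_cast this
  linarith

/-! ### Graphs without large bi-holes -/

/-- The bipartite graph in which the vertex `a` of `A` is joined to `e i a` for every `i`. -/
def unionGraph {n : ℕ} {ι : Type*} (e : ι → Equiv.Perm (Fin n)) : SimpleGraph (Fin n ⊕ Fin n) where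
  Adj u v := (∃ i a, u = Sum.inl a ∧ v = Sum.inr (e i a)) ∨
    (∃ i a, v = Sum.inl a ∧ u = Sum.inr (e i a))
  symm := ⟨fun _ _ h => h.symm⟩
  loopless := ⟨by rintro (u | u) <;> simp⟩

theorem unionGraph_adj {n : ℕ} {ι : Type*} (e : ι → Equiv.Perm (Fin n)) (a b : Fin n) :
    (unionGraph e).Adj (Sum.inl a) (Sum.inr b) ↔ ∃ i, e i a = b := by
  simp [unionGraph, eq_comm]

theorem isBipartiteNN_unionGraph {n : ℕ} {ι : Type*} (e : ι → Equiv.Perm (Fin n)) :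
    IsBipartiteNN (unionGraph e) := by
  rintro u v (⟨i, a, rfl, rfl⟩ | ⟨i, a, rfl, rfl⟩) <;> simp

theorem degree_unionGraph_le {n : ℕ} {ι : Type*} [Fintype ι] (e : ι → Equiv.Perm (Fin n))
    [DecidableRel (unionGraph e).Adj] (u : Fin n ⊕ Fin n) :
    (unionGraph e).degree u ≤ Fintype.card ι := by
  classical
  rw [← SimpleGraph.card_neighborFinset_eq_degree, ← Finset.card_univ]
  let f : ι → Fin n ⊕ Fin n := fun i =>
    Sum.elim (fun a => Sum.inr (e i a)) (fun b => Sum.inl ((e i).symm b)) u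
  refine (Finset.card_le_card (t := Finset.univ.image f) fun v hv => ?_).trans
    Finset.card_image_le
  rw [SimpleGraph.mem_neighborFinset] at hv
  obtain ⟨i, a, rfl, rfl⟩ | ⟨i, a, rfl, rfl⟩ := hv <;>
    exact Finset.mem_image.2 ⟨i, Finset.mem_univ _, by simp [f]⟩

open scoped Fin.NatCast Fin.CommRing in
theorem eq_univ_of_forall_add_one_mem {n : ℕ} [NeZero n] {X : Finset (Fin n)} (hX : X.Nonempty)
    (h : ∀ x ∈ X, x + 1 ∈ X) : X = Finset.univ := by
  obtain ⟨x, hx⟩ := hX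
  have hk : ∀ k : ℕ, x + (k : Fin n) ∈ X := by
    intro k
    induction k with
    | zero => simpa using hx
    | succ k ih => simpa [add_assoc] using h _ ih
  ext y
  have := hk (y - x).val
  simpa using this

/-- The extremal graph is the cycle of length `2 * n`: a proper nonempty subset `X` of `A` has at
least `|X| + 1` neighbours. -/
theorem two_mul_lt_of_mem_biholeSizes_two {n k : ℕ} (hn : 1 ≤ n) (hk : k ∈ biholeSizes n 2) :
    2 * k + 1 ≤ n := by
  classical
  have : NeZero n := ⟨by omega⟩
  let e : Fin 2 → Equiv.Perm (Fin n) := ![Equiv.refl _, Equiv.addRight 1]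
  obtain ⟨X, Y, hX, hY, hXY⟩ := hk (unionGraph e) (isBipartiteNN_unionGraph e)
    (fun a => by simpa using degree_unionGraph_le e (Sum.inl a))
  have h0 : ∀ x ∈ X, x ∉ Y := fun x hx hy =>
    hXY x hx x hy ((unionGraph_adj e x x).2 ⟨0, rfl⟩)
  have h1 : ∀ x ∈ X, x + 1 ∉ Y := fun x hx hy =>
    hXY x hx _ hy ((unionGraph_adj e x _).2 ⟨1, rfl⟩)
  have hd : Disjoint X Y := Finset.disjoint_left.2 h0
  have hle : X.card + Y.card ≤ n := by
    rw [← Finset.card_union_of_disjoint hd]; simpa using Finset.card_le_univ (X ∪ Y)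
  rcases X.eq_empty_or_nonempty with rfl | hne
  · simp at hX; omega
  by_contra hcon
  have huniv : X ∪ Y = Finset.univ := by
    rw [← Finset.card_eq_iff_eq_univ, Finset.card_union_of_disjoint hd, Fintype.card_fin]; omega
  have hX' : X = Finset.univ := eq_univ_of_forall_add_one_mem hne fun x hx => by
    have : x + 1 ∈ X ∪ Y := huniv ▸ Finset.mem_univ _
    exact (Finset.mem_union.1 this).resolve_right (h1 x hx)
  have : X.card = n := by rw [hX', Finset.card_univ, Fintype.card_fin]
  omega

/-- The number of permutations `σ` for which `σ X` misses `Y`, where `|X| = |Y| = k`. It depends only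
on `k`, so that it can be found by averaging over `X`. -/
theorem card_perm_image_disjoint {n k : ℕ} (X Y : Finset (Fin n)) (hX : X.card = k)
    (hY : Y.card = k) :
    (Finset.univ.filter fun σ : Equiv.Perm (Fin n) => ∀ x ∈ X, σ x ∉ Y).card * n.choose k =
      n.factorial * (n - k).choose k := by
  have hsymm : ∀ X' ∈ Finset.powersetCard k (Finset.univ : Finset (Fin n)),
      (Finset.univ.filter fun σ : Equiv.Perm (Fin n) => ∀ x ∈ X', σ x ∉ Y).card =
        (Finset.univ.filter fun σ : Equiv.Perm (Fin n) => ∀ x ∈ X, σ x ∉ Y).card := by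
    intro X' hX'
    have hc : X.card = X'.card := by rw [hX, (Finset.mem_powersetCard.1 hX').2]
    let τ : Equiv.Perm (Fin n) := (Finset.equivOfCardEq hc).extendSubtype
    have hτ : ∀ x, x ∈ X ↔ τ x ∈ X' := fun x =>
      ⟨fun hx => Equiv.extendSubtype_mem _ x hx, fun hx => by
        by_contra h; exact Equiv.extendSubtype_not_mem (Finset.equivOfCardEq hc) x h hx⟩
    refine Finset.card_bij (fun σ _ => σ * τ) ?_ (fun _ _ _ _ h => mul_right_cancel h) ?_
    · intro σ hσ
      simp only [Finset.mem_filter, Finset.mem_univ, true_and, Equiv.Perm.mul_apply] at hσ ⊢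
      exact fun x hx => hσ _ ((hτ x).1 hx)
    · intro σ hσ
      simp only [Finset.mem_filter, Finset.mem_univ, true_and] at hσ ⊢
      refine ⟨σ * τ⁻¹, fun x hx => ?_, by simp⟩
      rw [Equiv.Perm.mul_apply]
      exact hσ _ ((hτ _).2 (by simpa using hx))
  have hσ : ∀ σ : Equiv.Perm (Fin n),
      ((Finset.powersetCard k (Finset.univ : Finset (Fin n))).filter
        fun X' => ∀ x ∈ X', σ x ∉ Y).card = (n - k).choose k := by
    intro σ
    have : (Finset.powersetCard k (Finset.univ : Finset (Fin n))).filter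
        (fun X' => ∀ x ∈ X', σ x ∉ Y) =
        Finset.powersetCard k (Y.map σ.symm.toEmbedding)ᶜ := by
      ext X'
      simp only [Finset.mem_filter, Finset.mem_powersetCard, Finset.subset_univ, true_and]
      rw [and_comm]
      refine and_congr_left fun _ => forall₂_congr fun x _ => ?_
      simp
    rw [this, Finset.card_powersetCard, Finset.card_compl, Finset.card_map, hY, Fintype.card_fin]
  have hswap : ∑ X' ∈ Finset.powersetCard k (Finset.univ : Finset (Fin n)),
      (Finset.univ.filter fun σ : Equiv.Perm (Fin n) => ∀ x ∈ X', σ x ∉ Y).card =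
      ∑ σ : Equiv.Perm (Fin n), ((Finset.powersetCard k (Finset.univ : Finset (Fin n))).filter
        fun X' => ∀ x ∈ X', σ x ∉ Y).card := by
    simp_rw [Finset.card_filter]
    exact Finset.sum_comm
  rw [Finset.sum_congr rfl hsymm, Finset.sum_congr rfl fun σ _ => hσ σ, Finset.sum_const,
    Finset.sum_const, Finset.card_powersetCard, Finset.card_univ, Finset.card_univ,
    Fintype.card_perm, Fintype.card_fin, smul_eq_mul, smul_eq_mul] at hswap
  rw [mul_comm, hswap]

/-- First moment method: when the expected number of bi-holes of size `k` in the union of three random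
perfect matchings is less than one, some such union has none. -/
theorem not_mem_biholeSizesStar_three {n k : ℕ} (h : (n - k).choose k ^ 3 < n.choose k) :
    k ∉ biholeSizesStar n 3 := by
  classical
  intro hk
  let P := Finset.powersetCard k (Finset.univ : Finset (Fin n))
  let S : Finset (Fin n) × Finset (Fin n) → Finset (Equiv.Perm (Fin n)) := fun p =>
    Finset.univ.filter fun σ => ∀ x ∈ p.1, σ x ∉ p.2
  let bad : Finset (Fin 3 → Equiv.Perm (Fin n)) :=
    (P ×ˢ P).biUnion fun p => Fintype.piFinset fun _ => S p
  have hbad : bad = Finset.univ := by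
    ext e
    simp only [Finset.mem_univ, iff_true]
    obtain ⟨X, Y, hX, hY, hXY⟩ := hk (unionGraph e) (isBipartiteNN_unionGraph e)
      (SimpleGraph.maxDegree_le_of_forall_degree_le _ _ fun u => by
        simpa using degree_unionGraph_le e u)
    refine Finset.mem_biUnion.2 ⟨(X, Y), by simp [P, hX, hY], Fintype.mem_piFinset.2 fun i => ?_⟩
    simp only [S, Finset.mem_filter, Finset.mem_univ, true_and]
    exact fun x hx hy => hXY x hx _ hy ((unionGraph_adj e x _).2 ⟨i, rfl⟩)
  have hcard : ∀ p ∈ P ×ˢ P, (Fintype.piFinset fun _ : Fin 3 => S p).card * n.choose k ^ 3 =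
      (n.factorial * (n - k).choose k) ^ 3 := by
    intro p hp
    obtain ⟨h1, h2⟩ := Finset.mem_product.1 hp
    rw [Fintype.card_piFinset_const, ← mul_pow,
      card_perm_image_disjoint p.1 p.2 (Finset.mem_powersetCard.1 h1).2
        (Finset.mem_powersetCard.1 h2).2]
  have hle : n.factorial ^ 3 * n.choose k ^ 3 ≤
      n.choose k ^ 2 * (n.factorial * (n - k).choose k) ^ 3 := by
    calc n.factorial ^ 3 * n.choose k ^ 3 = bad.card * n.choose k ^ 3 := by
          rw [hbad, Finset.card_univ, Fintype.card_fun, Fintype.card_perm, Fintype.card_fin,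
            Fintype.card_fin]
      _ ≤ (∑ p ∈ P ×ˢ P, (Fintype.piFinset fun _ : Fin 3 => S p).card) * n.choose k ^ 3 :=
          Nat.mul_le_mul_right _ Finset.card_biUnion_le
      _ = _ := by
          rw [Finset.sum_mul, Finset.sum_congr rfl hcard, Finset.sum_const, Finset.card_product,
            Finset.card_powersetCard, Finset.card_univ, Fintype.card_fin, smul_eq_mul, sq]
  have hc : 0 < n.choose k := by omega
  have hlt : n.choose k ^ 2 * (n.factorial * (n - k).choose k) ^ 3 <
      n.factorial ^ 3 * n.choose k ^ 3 := by
    calc _ = (n.factorial ^ 3 * n.choose k ^ 2) * (n - k).choose k ^ 3 := by ring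
      _ < (n.factorial ^ 3 * n.choose k ^ 2) * n.choose k :=
          Nat.mul_lt_mul_of_pos_left h (by have := n.factorial_pos; positivity)
      _ = _ := by ring
  omega

/-! ### The asymptotic estimate -/

theorem le_log_factorial {n : ℕ} (hn : n ≠ 0) :
    (n : ℝ) * Real.log n - n ≤ Real.log n.factorial := by
  have h := Stirling.le_log_factorial_stirling hn
  have h1 : 0 ≤ Real.log n := Real.log_natCast_nonneg n
  have h2 : 0 ≤ Real.log (2 * Real.pi) := Real.log_nonneg (by linarith [Real.pi_gt_three])
  linarith

theorem log_factorial_le {n : ℕ} (hn : n ≠ 0) :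
    Real.log n.factorial ≤ n * Real.log n - n + Real.log n + 1 := by
  obtain ⟨m, rfl⟩ := Nat.exists_eq_succ_of_ne_zero hn
  have h := Stirling.log_stirlingSeq_formula m.succ
  have h1 := Stirling.log_stirlingSeq'_antitone (Nat.zero_le m)
  simp only [Function.comp_apply] at h1
  have h2 : Real.log (Stirling.stirlingSeq (Nat.succ 0)) = 1 - Real.log 2 / 2 := by
    rw [show Nat.succ 0 = 1 from rfl, Stirling.stirlingSeq_one,
      Real.log_div (Real.exp_ne_zero _) (by positivity), Real.log_exp, Real.log_sqrt (by norm_num)]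
  have hpos : (0 : ℝ) < (m.succ : ℕ) := by exact_mod_cast Nat.succ_pos m
  have hl : 0 ≤ Real.log (m.succ : ℕ) := Real.log_natCast_nonneg _
  rw [Real.log_div hpos.ne' (Real.exp_ne_zero _), Real.log_exp,
    Real.log_mul two_ne_zero hpos.ne'] at h
  rw [h2] at h1
  nlinarith

/-- The exponential growth rate, in terms of `t = k / n`, of the expected number
`(n - k).choose k ^ 3 / n.choose k` of bi-holes of size `k`. -/
noncomputable def biholeRate (t : ℝ) : ℝ :=
  4 * ((1 - t) * Real.log (1 - t)) - 2 * (t * Real.log t) -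
    3 * ((1 - 2 * t) * Real.log (1 - 2 * t))

theorem continuous_biholeRate : Continuous biholeRate := by
  have h := Real.continuous_mul_log
  exact (((h.comp (continuous_const.sub continuous_id)).const_mul 4).sub (h.const_mul 2)).sub
    ((h.comp (continuous_const.sub (continuous_const.mul continuous_id))).const_mul 3)

set_option exponentiation.threshold 11000 in
theorem biholeRate_neg : biholeRate 0.4591 < 0 := by
  -- the inequality `10000 / 2 * biholeRate 0.4591 < 0`, exponentiated
  have h : (5409 : ℕ) ^ 10818 < 10000 ^ 5000 * 4591 ^ 4591 * 818 ^ 1227 := by norm_num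
  have h' : (5409 : ℝ) ^ 10818 < 10000 ^ 5000 * 4591 ^ 4591 * 818 ^ 1227 := by exact_mod_cast h
  have hlog := Real.log_lt_log (by positivity) h'
  rw [Real.log_mul (by positivity) (by positivity), Real.log_mul (by positivity) (by positivity),
    Real.log_pow, Real.log_pow, Real.log_pow, Real.log_pow] at hlog
  have e1 : Real.log (1 - 0.4591) = Real.log 5409 - Real.log 10000 := by
    rw [← Real.log_div (by norm_num) (by norm_num)]; norm_num
  have e2 : Real.log 0.4591 = Real.log 4591 - Real.log 10000 := by
    rw [← Real.log_div (by norm_num) (by norm_num)]; norm_num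
  have e3 : Real.log (1 - 2 * 0.4591) = Real.log 818 - Real.log 10000 := by
    rw [← Real.log_div (by norm_num) (by norm_num)]; norm_num
  rw [biholeRate, e1, e2, e3]
  push_cast at hlog
  linarith

theorem choose_pow_three_lt_choose {n k : ℕ} (hk : 0 < k) (hkn : 2 * k < n)
    (h : n * biholeRate (k / n) + 4 * (Real.log n + 1) < 0) :
    (n - k).choose k ^ 3 < n.choose k := by
  obtain ⟨m, rfl⟩ := Nat.exists_eq_add_of_lt hkn
  have e1 : 2 * k + m + 1 - k = k + m + 1 := by omega
  rw [e1]
  set c := (k + m + 1).choose k with hc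
  set d := (2 * k + m + 1).choose k with hd
  have hc1 : c * k.factorial * (m + 1).factorial = (k + m + 1).factorial := by
    have := Nat.choose_mul_factorial_mul_factorial (show k ≤ k + m + 1 by omega)
    rwa [show k + m + 1 - k = m + 1 by omega] at this
  have hd1 : d * k.factorial * (k + m + 1).factorial = (2 * k + m + 1).factorial := by
    have := Nat.choose_mul_factorial_mul_factorial (show k ≤ 2 * k + m + 1 by omega)
    rwa [e1] at this
  have hcpos : 0 < c := Nat.choose_pos (by omega)
  have hdpos : 0 < d := Nat.choose_pos (by omega)
  have lg : ∀ {a b x y : ℕ}, 0 < a → a * b.factorial * x.factorial = y.factorial →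
      Real.log a + Real.log b.factorial + Real.log x.factorial = Real.log y.factorial := by
    intro a b x y ha hy
    have hb : (b.factorial : ℝ) ≠ 0 := by exact_mod_cast b.factorial_ne_zero
    have hx : (x.factorial : ℝ) ≠ 0 := by exact_mod_cast x.factorial_ne_zero
    have ha' : (a : ℝ) ≠ 0 := by exact_mod_cast ha.ne'
    rw [← Real.log_mul ha' hb, ← Real.log_mul (mul_ne_zero ha' hb) hx, ← hy]
    push_cast; rfl
  have lc := lg hcpos hc1
  have ld := lg hdpos hd1
  have b1 := le_log_factorial hk.ne'
  have b2 := le_log_factorial (Nat.succ_ne_zero m)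
  have b3 := le_log_factorial (show 2 * k + m + 1 ≠ 0 by omega)
  have b4 := log_factorial_le (show k + m + 1 ≠ 0 by omega)
  set n := 2 * k + m + 1 with hn
  have hn0 : (0 : ℝ) < n := by exact_mod_cast (show 0 < n by omega)
  have hk0 : (0 : ℝ) < k := by exact_mod_cast hk
  have r1 : (n : ℝ) * (1 - k / n) = (k + m + 1 : ℕ) := by
    rw [hn] at hn0 ⊢; field_simp; push_cast; ring
  have r2 : (n : ℝ) * (1 - 2 * (k / n)) = (m + 1 : ℕ) := by
    rw [hn] at hn0 ⊢; field_simp; push_cast; ring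
  have r3 : (n : ℝ) * (k / n) = k := by field_simp
  -- scaling: `n * (t * log t) = x * log x - x * log n` for `x = n * t`
  have sc : ∀ t x : ℝ, 0 < x → n * t = x →
      n * (t * Real.log t) = x * Real.log x - x * Real.log n := by
    intro t x hx hxt
    have ht : t = x / n := by rw [← hxt]; field_simp
    rw [ht, Real.log_div hx.ne' hn0.ne']
    field_simp
  have s1 := sc _ _ (by positivity) r1
  have s2 := sc _ _ (by positivity) r2
  have s3 := sc _ _ hk0 r3
  have hl : Real.log (k + m + 1 : ℕ) ≤ Real.log n :=
    Real.log_le_log (by positivity) (by exact_mod_cast (show k + m + 1 ≤ n by omega))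
  have hexp : (n : ℝ) * biholeRate (k / n) =
      4 * ((k + m + 1 : ℕ) * Real.log (k + m + 1 : ℕ)) - 2 * (k * Real.log k)
        - 3 * ((m + 1 : ℕ) * Real.log (m + 1 : ℕ)) - n * Real.log n := by
    have hsum : (4 * (k + m + 1 : ℕ) - 2 * k - 3 * (m + 1 : ℕ) : ℝ) = n := by
      rw [hn]; push_cast; ring
    rw [biholeRate]
    linear_combination 4 * s1 - 2 * s3 - 3 * s2 - Real.log n * hsum
  have hfin : 3 * Real.log c < Real.log d := by
    rw [hexp] at h
    push_cast at *
    nlinarith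
  have : Real.log ((c ^ 3 : ℕ) : ℝ) < Real.log d := by
    push_cast; rw [Real.log_pow]; exact_mod_cast hfin
  have := (Real.log_lt_log_iff (by positivity) (by positivity)).1 this
  exact_mod_cast this

theorem eventually_biholeNumberStar_three_lt :
    ∀ᶠ n : ℕ in Filter.atTop, (biholeNumberStar n 3 : ℝ) < 0.4591 * n := by
  have ht : Filter.Tendsto (fun n : ℕ => (⌈(0.4591 : ℝ) * n⌉₊ : ℝ) / n) Filter.atTop
      (nhds 0.4591) :=
    (tendsto_nat_ceil_mul_div_atTop (by norm_num)).comp tendsto_natCast_atTop_atTop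
  have hr := (continuous_biholeRate.tendsto 0.4591).comp ht
  have hlog : Filter.Tendsto (fun n : ℕ => (Real.log n + 1) / n) Filter.atTop (nhds 0) := by
    have h1 := (Real.isLittleO_log_id_atTop.tendsto_div_nhds_zero).comp
      (tendsto_natCast_atTop_atTop (R := ℝ))
    have h2 := tendsto_one_div_atTop_nhds_zero_nat (𝕜 := ℝ)
    simpa [add_div] using h1.add h2
  have hsum := hr.add (hlog.const_mul 4)
  rw [mul_zero, add_zero] at hsum
  filter_upwards [hsum.eventually_lt_const biholeRate_neg, Filter.eventually_gt_atTop 1000]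
    with n hn hn1
  by_contra! hcon
  have hn0 : (0 : ℝ) < n := by exact_mod_cast (show 0 < n by omega)
  set k := ⌈(0.4591 : ℝ) * n⌉₊ with hk
  have hkle : k ≤ biholeNumberStar n 3 := Nat.ceil_le.2 hcon
  have hk0 : 0 < k := Nat.ceil_pos.2 (by positivity)
  have hkn : 2 * k < n := by
    have h1 : (k : ℝ) < 0.4591 * n + 1 := Nat.ceil_lt_add_one (by positivity)
    have h2 : (1000 : ℝ) < n := by exact_mod_cast hn1
    have : (2 * k : ℝ) < n := by linarith
    exact_mod_cast this
  refine not_mem_biholeSizesStar_three (choose_pow_three_lt_choose hk0 hkn ?_) ?_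
  · simp only [Function.comp_apply] at hn
    have := mul_neg_of_pos_of_neg hn0 hn
    rwa [mul_add, show (n : ℝ) * (4 * ((Real.log n + 1) / n)) = 4 * (Real.log n + 1) by
      field_simp] at this
  · intro G _ hG hdeg
    obtain ⟨X, Y, hX, hY, hXY⟩ := (isGreatest_biholeNumberStar n 3).1 G hG hdeg
    obtain ⟨X', hX', hXk⟩ := Finset.exists_subset_card_eq (hX.symm ▸ hkle)
    obtain ⟨Y', hY', hYk⟩ := Finset.exists_subset_card_eq (hY.symm ▸ hkle)
    exact ⟨X', Y', hXk, hYk, fun x hx y hy => hXY x (hX' hx) y (hY' hy)⟩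

theorem biholeNumber_le_biholeNumberStar (n Δ : ℕ) :
    biholeNumber n Δ ≤ biholeNumberStar n Δ :=
  (isGreatest_biholeNumberStar n Δ).2 fun G _ hG hdeg =>
    (isGreatest_biholeNumber n Δ).1 G hG fun _ => (G.degree_le_maxDegree _).trans hdeg

theorem theorem1p5 :
    (∀ Δ n : ℕ, 2 ≤ Δ → ⌊((n : ℝ) - 2) / (Δ : ℝ)⌋ ≤ (biholeNumber n Δ : ℤ)) ∧
    (∀ n : ℕ, 1 ≤ n → (biholeNumber n 2 : ℤ) = ⌈(n : ℝ) / 2⌉ - 1) ∧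
    (∃ n₀ : ℕ, ∀ n : ℕ, n₀ < n →
      (0.3411 : ℝ) * n < (biholeNumber n 3 : ℝ) ∧
      biholeNumber n 3 ≤ biholeNumberStar n 3 ∧
      (biholeNumberStar n 3 : ℝ) < (0.4591 : ℝ) * n) := by
  refine ⟨fun Δ n hΔ => ?_, fun n hn => ?_, ?_⟩
  · by_contra! hlt
    set j := ⌊((n : ℝ) - 2) / (Δ : ℝ)⌋ with hj
    obtain ⟨k, hk⟩ := Int.eq_ofNat_of_zero_le (show 0 ≤ j by omega)
    have hΔ0 : (0 : ℝ) < Δ := by exact_mod_cast (show 0 < Δ by omega)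
    have h1 : (j : ℝ) ≤ ((n : ℝ) - 2) / Δ := Int.floor_le _
    rw [hk, le_div_iff₀ hΔ0] at h1
    push_cast at h1
    have h2 : ((Δ * k + 1 : ℕ) : ℝ) ≤ n := by push_cast; nlinarith
    have h3 := (isGreatest_biholeNumber n Δ).2
      (mem_biholeSizes_of_mul_lt hΔ (by exact_mod_cast h2))
    omega
  · have hlow := (isGreatest_biholeNumber n 2).2
      (mem_biholeSizes_of_mul_lt (n := n) (k := (n - 1) / 2) le_rfl (by omega))
    have hup := two_mul_lt_of_mem_biholeSizes_two hn (isGreatest_biholeNumber n 2).1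
    have hceil : ⌈(n : ℝ) / 2⌉ = (biholeNumber n 2 : ℤ) + 1 := by
      have h1 : ((2 * biholeNumber n 2 + 1 : ℕ) : ℝ) ≤ n := by exact_mod_cast hup
      have h2 : (n : ℝ) ≤ ((2 * biholeNumber n 2 + 2 : ℕ) : ℝ) := by
        exact_mod_cast (show n ≤ 2 * biholeNumber n 2 + 2 by omega)
      push_cast at h1 h2
      rw [Int.ceil_eq_iff]
      push_cast
      constructor <;> linarith
    omega
  · obtain ⟨N, hN⟩ := Filter.eventually_atTop.1 eventually_biholeNumberStar_three_lt
    refine ⟨max N 30000, fun n hn => ⟨lt_biholeNumber_three (by omega),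
      biholeNumber_le_biholeNumberStar n 3, hN n (by omega)⟩⟩
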